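/- Universal approximation by Lipschitz Transformers. Throughout, $\mathbb{R}^d$ carries the Euclidean norm, $\|W\|_2$ is the spectral norm of a matrix, $\mathcal{P}(\Omega)$ is the set of Borel probability measures on $\Omega\subset\mathbb{R}^d$, $T_\sharp\mu$ is the push-forward, $W_1$ is the Wasserstein-1 distance (the infimum of $\int\|x-y\|_2\,d\pi(x,y)$ over couplings $\pi$), and $\sigma=\mathrm{ReLU}$ acts coordinatewise. For $\Omega,\Omega'\subset\mathbb{R}^h$: (i) $\mathcal{E}_{h,\Omega,\Omega'}$ is the set of maps $F(x)=x-\tau W^\top\sigma(Wx+b)$ on $\mathbb{R}^h$ with $k\in\mathbb{N}$, $W\in\mathbb{R}^{k\times h}$, $b\in\mathbb{R}^k$, $\tau\ge 0$, $\tau\|W\|_2^2\le 2$ and $F(\Omega)\subset\Omega'$. Put $\bar F(\mu,x)=(F_\sharp\mu,F(x))$. (ii) $\mathcal{V}_{h,\Omega,\Omega'}$ is the set of maps $$\Gamma(\mu,x)=x-\eta\int\frac{e^{\langle x,Ay\rangle}}{\int e^{\langle x,Az\rangle}\,d\mu(z)}\,Ay\,d\mu(y)$$ on $\mathcal{P}(\Omega)\times\Omega$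 with $A\in\mathbb{R}^{h\times h}$, $\eta\ge0$, $\eta\|Ay\|_2^2\le 2$ for all $y\in\Omega$, and $\Gamma(\mathcal{P}(\Omega)\times\Omega)\subset\Omega'$. Put $\bar\Gamma(\mu,x)=(\Gamma(\mu,\cdot)_\sharp\mu,\Gamma(\mu,x))$. (iii) For compact $\Omega_1\subset\mathbb{R}^h$, $\mathcal{T}_{h,\Omega_1}$ is the set of maps $T=\pi_2\circ\bar F_L\circ\bar\Gamma_L\circ\cdots\circ\bar F_1\circ\bar\Gamma_1:\mathcal{P}(\Omega_1)\times\Omega_1\to\mathbb{R}^h$, where $\pi_2(\mu,x)=x$, $L\ge1$, and there are compact sets $\tilde\Omega_1,\Omega_2,\tilde\Omega_2,\dots,\tilde\Omega_L,\Omega_{L+1}\subset\mathbb{R}^h$ with $\Gamma_\ell\in\mathcal{V}_{h,\Omega_\ell,\tilde\Omega_\ell}$ and $F_\ell\in\mathcal{E}_{h,\tilde\Omega_\ell,\Omega_{\ell+1}}$ for $\ell=1,\dots,L$. Let $C>0$, $d\in\mathbb{N}$, let $\Omega\subset\mathbb{R}^d$ be compact and $\mathcal{X}=\mathcal{P}(\Omega)\times\Omega$.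 Let $\mathcal{C}_{1,C}(\mathcal{X},\mathbb{R})$ be the set of $\Lambda:\mathcal{X}\to\mathbb{R}$ such that $\Lambda(\mu,\cdot)$ is $1$-Lipschitz on $(\Omega,\|\cdot\|_2)$ for every $\mu\in\mathcal{P}(\Omega)$ and $\Lambda(\cdot,x)$ is $C$-Lipschitz on $(\mathcal{P}(\Omega),W_1)$ for every $x\in\Omega$. Let $\mathcal{G}_C(\mathcal{X},\mathbb{R})$ be the set of those $\Lambda\in\mathcal{C}_{1,C}(\mathcal{X},\mathbb{R})$ of the form $$\Lambda(\mu,x)=v^\top T(Q_\sharp\mu,Q(x)),\qquad Q(x)=Ax+b,$$ with $h\in\mathbb{N}$, $A\in\mathbb{R}^{h\times d}$, $b,v\in\mathbb{R}^h$, $\Omega_1\subset\mathbb{R}^h$ compact with $Q(\Omega)\subset\Omega_1$, and $T\in\mathcal{T}_{h,\Omega_1}$. Theorem. For every $\varepsilon\in(0,1)$ and every $\Lambda^*\in\mathcal{C}_{1,C}(\mathcal{X},\mathbb{R})$ there is $\Lambda\in\mathcal{G}_C(\mathcal{X},\mathbb{R})$ such that $$\sup_{(\mu,x)\in\mathcal{X}}|\Lambda(\mu,x)-\Lambda^*(\mu,x)|\le\varepsilon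 .$$ -/

import Mathlib

open MeasureTheory

noncomputable section

namespace LipTransformer

/-- Euclidean space `ℝ^d`, with the Euclidean norm. Real `m × n` matrices are represented by
the continuous linear maps `E n →L[ℝ] E m`: the operator norm is the spectral norm and the
adjoint is the transpose. -/
abbrev E (d : ℕ) : Type := EuclideanSpace ℝ (Fin d)

/-- `𝒫(Ω)`: the Borel probability measures on `ℝ^d` that are concentrated on `Ω`. -/
def Prob {d : ℕ} (Ω : Set (E d)) : Set (ProbabilityMeasure (E d)) :=
  {μ | (μ : Measure (E d)) Ωᶜ = 0}

/-- `π` is a coupling of `μ` and `ν`. -/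
def IsCoupling {d : ℕ} (π : Measure (E d × E d)) (μ ν : ProbabilityMeasure (E d)) : Prop :=
  π.map Prod.fst = (μ : Measure (E d)) ∧ π.map Prod.snd = (ν : Measure (E d))

/-- The Wasserstein distance `W₁` (finite for measures on a bounded set). -/
def W₁ {d : ℕ} (μ ν : ProbabilityMeasure (E d)) : ENNReal :=
  ⨅ (π : Measure (E d × E d)) (_ : IsCoupling π μ ν), ∫⁻ p, edist p.1 p.2 ∂π

/-! ### MLP layers -/

/-- `ReLU`, applied coordinatewise. -/
def relu {k : ℕ} (x : E k) : E k := WithLp.toLp 2 fun i => max (x i) 0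

/-- The gradient-descent-type MLP map `x ↦ x - τ Wᵀ σ(W x + b)` with `σ = ReLU`. -/
def mlp {d k : ℕ} (W : E d →L[ℝ] E k) (b : E k) (τ : ℝ) (x : E d) : E d :=
  x - τ • W.adjoint (relu (W x + b))

theorem measurable_mlp {d k : ℕ} (W : E d →L[ℝ] E k) (b : E k) (τ : ℝ) :
    Measurable (mlp W b τ) := by
  have h : Continuous (relu (k := k)) := by
    unfold relu
    fun_prop
  unfold mlp
  exact (by fun_prop : Continuous fun x => x - τ • W.adjoint (relu (W x + b))).measurable

/-- An MLP layer of the class `ℰ_{d,Ω,Ω'}`: a gradient-descent-type MLP map with step size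
`τ ∈ [0, 2 / ‖W‖²]` that maps `Ω` into `Ω'`. The upper bound is written without a division;
for `W = 0` it is void, and the map is then the identity for every `τ`. -/
structure MLPLayer (d : ℕ) (Ω Ω' : Set (E d)) where
  k : ℕ
  W : E d →L[ℝ] E k
  b : E k
  τ : ℝ
  step_nonneg : 0 ≤ τ
  step_le : τ * ‖W‖ ^ 2 ≤ 2
  mapsTo : ∀ x ∈ Ω, mlp W b τ x ∈ Ω'

/-- The context-free extension `(μ, x) ↦ (F_♯ μ, F(x))` of an MLP layer `F`. -/
def MLPLayer.bar {d : ℕ} {Ω Ω' : Set (E d)} (F : MLPLayer d Ω Ω')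
    (p : ProbabilityMeasure (E d) × E d) : ProbabilityMeasure (E d) × E d :=
  (p.1.map (measurable_mlp F.W F.b F.τ).aemeasurable, mlp F.W F.b F.τ p.2)

/-! ### Attention layers -/

/-- The gradient-descent-type in-context attention map
`(μ, x) ↦ x - η ∫ (exp ⟨x, A y⟩ / ∫ exp ⟨x, A z⟩ dμ(z)) A y dμ(y)`.
The integrals converge for compactly supported `μ`. -/
def attention {d : ℕ} (A : E d →L[ℝ] E d) (η : ℝ)
    (μ : ProbabilityMeasure (E d)) (x : E d) : E d :=
  x - η • ∫ y, (Real.exp (inner ℝ x (A y)) /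
    ∫ z, Real.exp (inner ℝ x (A z)) ∂(μ : Measure (E d))) • A y ∂(μ : Measure (E d))

theorem measurable_attention {d : ℕ} (A : E d →L[ℝ] E d) (η : ℝ)
    (μ : ProbabilityMeasure (E d)) : Measurable (attention A η μ) := by
  have h1 : StronglyMeasurable fun x : E d =>
      ∫ z, Real.exp (inner ℝ x (A z)) ∂(μ : Measure (E d)) := by
    apply StronglyMeasurable.integral_prod_right (f := fun x z => Real.exp (inner ℝ x (A z)))
    exact (by fun_prop : Continuous fun p : E d × E d =>
      Real.exp (inner ℝ p.1 (A p.2))).stronglyMeasurable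
  have h2 : StronglyMeasurable fun x : E d => ∫ y, (Real.exp (inner ℝ x (A y)) /
      ∫ z, Real.exp (inner ℝ x (A z)) ∂(μ : Measure (E d))) • A y ∂(μ : Measure (E d)) := by
    apply StronglyMeasurable.integral_prod_right (f := fun x y => (Real.exp (inner ℝ x (A y)) /
      ∫ z, Real.exp (inner ℝ x (A z)) ∂(μ : Measure (E d))) • A y)
    have h3 : Measurable fun p : E d × E d => Real.exp (inner ℝ p.1 (A p.2)) :=
      (by fun_prop : Continuous fun p : E d × E d => Real.exp (inner ℝ p.1 (A p.2))).measurable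
    have h4 : Measurable fun p : E d × E d => A p.2 :=
      (by fun_prop : Continuous fun p : E d × E d => A p.2).measurable
    exact ((h3.div (h1.measurable.comp measurable_fst)).smul h4).stronglyMeasurable
  exact measurable_id.sub (h2.measurable.const_smul η)

/-- A self-attention layer of the class `𝒱_{d,Ω,Ω'}`: a gradient-descent-type attention map with
step size `η ∈ [0, 2 / sup_{y ∈ Ω} ‖A y‖²]` that maps `𝒫(Ω) × Ω` into `Ω'`. The upper bound is
written without a division; if `A` vanishes on `Ω` it is void, and the map is then the identity
on `𝒫(Ω) × Ω` for every `η`. -/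
structure AttentionLayer (d : ℕ) (Ω Ω' : Set (E d)) where
  A : E d →L[ℝ] E d
  η : ℝ
  step_nonneg : 0 ≤ η
  step_le : ∀ y ∈ Ω, η * ‖A y‖ ^ 2 ≤ 2
  mapsTo : ∀ μ ∈ Prob Ω, ∀ x ∈ Ω, attention A η μ x ∈ Ω'

/-- The in-context extension `(μ, x) ↦ (Γ(μ)_♯ μ, Γ(μ, x))` of an attention layer `Γ`. -/
def AttentionLayer.bar {d : ℕ} {Ω Ω' : Set (E d)} (Γ : AttentionLayer d Ω Ω')
    (p : ProbabilityMeasure (E d) × E d) : ProbabilityMeasure (E d) × E d :=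
  (p.1.map (measurable_attention Γ.A Γ.η p.1).aemeasurable, attention Γ.A Γ.η p.1 p.2)

/-! ### Deep Transformers -/

/-- `Composition Ω L S Ω'`: the map `S` is a composition `F̄_L ∘ Γ̄_L ∘ ⋯ ∘ F̄_1 ∘ Γ̄_1` of `L`
pairs of layers with `Γ_ℓ ∈ 𝒱_{d,Ω_ℓ,Ω̃_ℓ}` and `F_ℓ ∈ ℰ_{d,Ω̃_ℓ,Ω_{ℓ+1}}`, where the sets
`Ω_1 = Ω, Ω̃_1, Ω_2, …, Ω̃_L, Ω_{L+1} = Ω'` are compact. -/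
inductive Composition {d : ℕ} (Ω : Set (E d)) :
    ℕ → (ProbabilityMeasure (E d) × E d → ProbabilityMeasure (E d) × E d) → Set (E d) → Prop
  | nil (hΩ : IsCompact Ω) : Composition Ω 0 id Ω
  | layer {L : ℕ} {S : ProbabilityMeasure (E d) × E d → ProbabilityMeasure (E d) × E d}
      {Ωl Ωt Ω' : Set (E d)} (hS : Composition Ω L S Ωl)
      (hΩt : IsCompact Ωt) (hΩ' : IsCompact Ω')
      (Γ : AttentionLayer d Ωl Ωt) (F : MLPLayer d Ωt Ω') :
      Composition Ω (L + 1) (F.bar ∘ Γ.bar ∘ S) Ω'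

/-- The class `𝒯_{d,Ω}` of deep Lipschitz Transformers `T = π₂ ∘ F̄_L ∘ Γ̄_L ∘ ⋯ ∘ F̄_1 ∘ Γ̄_1`,
`L ≥ 1`. They are regarded as maps on `𝒫(Ω) × Ω`; the formula is written on all of
`𝒫(ℝ^d) × ℝ^d`. -/
def Transformers {d : ℕ} (Ω : Set (E d)) : Set (ProbabilityMeasure (E d) × E d → E d) :=
  {T | ∃ (L : ℕ) (S : ProbabilityMeasure (E d) × E d → ProbabilityMeasure (E d) × E d)
    (Ω' : Set (E d)), 1 ≤ L ∧ Composition Ω L S Ω' ∧ T = Prod.snd ∘ S}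

/-- The context-free extension `(μ, x) ↦ (Q_♯ μ, Q(x))` of the affine map `Q(x) = A x + b`. -/
def liftBar {d h : ℕ} (A : E d →L[ℝ] E h) (b : E h)
    (p : ProbabilityMeasure (E d) × E d) : ProbabilityMeasure (E h) × E h :=
  (p.1.map (f := fun x => A x + b) (A.continuous.measurable.add_const b).aemeasurable,
    A p.2 + b)

/-! ### The function classes -/

/-- The class `𝒞_{1,C}(𝒫(Ω) × Ω, ℝ)`: `1`-Lipschitz in the query, `C`-Lipschitz in the context
with respect to `W₁`. -/
def LipClass {d : ℕ} (Ω : Set (E d)) (C : ℝ) : Set (Prob Ω × Ω → ℝ) :=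
  {Λ | (∀ (μ : Prob Ω) (x y : Ω), |Λ (μ, x) - Λ (μ, y)| ≤ ‖(x : E d) - (y : E d)‖) ∧
    ∀ (μ ν : Prob Ω) (x : Ω),
      ENNReal.ofReal |Λ (μ, x) - Λ (ν, x)| ≤ ENNReal.ofReal C * W₁ μ.1 ν.1}

/-- The class `𝒦(𝒫(Ω) × Ω, ℝ)` of the maps `vᵀ ∘ T ∘ Q̄` with `Q` affine, `Q(Ω) ⊆ Ω₁`, `Ω₁`
compact and `T` a deep Lipschitz Transformer on `Ω₁`. -/
def LiftedTransformers {d : ℕ} (Ω : Set (E d)) : Set (Prob Ω × Ω → ℝ) :=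
  {Λ | ∃ (h : ℕ) (A : E d →L[ℝ] E h) (b v : E h) (Ω₁ : Set (E h))
    (T : ProbabilityMeasure (E h) × E h → E h),
    IsCompact Ω₁ ∧ (∀ x ∈ Ω, A x + b ∈ Ω₁) ∧ T ∈ Transformers Ω₁ ∧
      ∀ (μ : Prob Ω) (x : Ω), Λ (μ, x) = inner ℝ v (T (liftBar A b (μ.1, x.1)))}

/-- The class `𝒢_C(𝒫(Ω) × Ω, ℝ) = 𝒞_{1,C} ∩ 𝒦`. -/
def 𝒢 {d : ℕ} (Ω : Set (E d)) (C : ℝ) : Set (Prob Ω × Ω → ℝ) :=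
  LipClass Ω C ∩ LiftedTransformers Ω

end LipTransformer

end

/-!
The proof writes the approximant down explicitly, as a function of the form

  `Λ(μ, x) = max_i min_j (γ_ij - ⟨u_ij, x⟩ - C ∫ φ_ij dμ)`,
  `φ_ij(y) = max_k min_l (α_ijkl - ⟨w_ijkl, y⟩)`, with `‖u_ij‖, ‖w_ijkl‖ ≤ 1`,

and it consists of two independent parts.

*Approximation.* `LipClass Ω C` is the set of the `1`-Lipschitz functions for the metric
`C W₁ + ‖·‖` on `𝒫(Ω) × Ω`, which is totally bounded (`exists_finite_W₁_net`). A maximum of minima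
of `1`-Lipschitz functions approximates a `1`-Lipschitz function as soon as the entry `(i, j)` of
the array has the right value at the `i`-th point of a net and is not much too large at the `j`-th
one (`abs_maxMin_sub_le_of_net`). So the entry has to decrease from point `i` to point `j` as
fast as the metric allows: in the query this is done by a linear function, in the context by the
integral of a nearly optimal potential of Kantorovich-Rubinstein duality
(`exists_lipschitz_W₁_le`). The duality is reduced, by cutting `Ω` into small cells, to a finite
one, which follows from the Hahn-Banach theorem (`discrete_kantorovich`). The potentials are in
turn replaced by maxima of minima of affine functions (`exists_maxMin_affine_approx`).

*Realization.* Such a function is computed exactly by a Transformer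
(`maxMin_mem_liftedTransformers`). The MLP layer with the single row `(e_a - e_b)ᵀ` and unit step
size is a comparator: it replaces `(x_a, x_b)` by `(min(x_a, x_b), max(x_a, x_b))`. The lifting `Q`
provides all the affine functions as coordinates, and comparator networks turn them into maxima of
minima. If the state is orthogonal to all the values `A y`, attention is plain averaging
over the context, and the step size constraint disappears by making `A` small and `η` large
(`exists_averaging_layer`). Orthogonality is arranged by keeping the receiving coordinates in pairs
of opposite sign. As everything is exact, the Lipschitz constants `1` and `C` are not lost.
-/

namespace LipTransformer

/-! ### Comparators -/

/-- The comparator gate on the coordinates `a` and `b`: it moves the smaller of the two values to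
`a` and the larger one to `b`. -/
noncomputable def comparator {h : ℕ} (a b : Fin h) (x : E h) : E h :=
  x - max (x a - x b) 0 • (EuclideanSpace.single a (1 : ℝ) - EuclideanSpace.single b (1 : ℝ))

theorem comparator_left {h : ℕ} {a b : Fin h} (hab : a ≠ b) (x : E h) :
    comparator a b x a = min (x a) (x b) := by
  simp [comparator, hab]
  grind

theorem comparator_right {h : ℕ} {a b : Fin h} (hab : a ≠ b) (x : E h) :
    comparator a b x b = max (x a) (x b) := by
  simp [comparator, hab.symm]
  grind

theorem comparator_of_ne {h : ℕ} {a b c : Fin h} (ha : c ≠ a) (hb : c ≠ b) (x : E h) :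
    comparator a b x c = x c := by
  simp [comparator, ha, hb]

/-- The row vector `wᵀ` as a linear map to `ℝ¹`. -/
noncomputable def rowMap {h : ℕ} (w : E h) : E h →L[ℝ] E 1 :=
  (innerSL ℝ w).smulRight (EuclideanSpace.single 0 1)

theorem rowMap_apply {h : ℕ} (w x : E h) (i : Fin 1) : rowMap w x i = inner ℝ w x := by
  simp [rowMap, Subsingleton.elim i 0]

theorem adjoint_rowMap {h : ℕ} (w : E h) (y : E 1) : (rowMap w).adjoint y = y 0 • w := by
  refine ext_inner_right ℝ fun x => ?_
  rw [ContinuousLinearMap.adjoint_inner_left, real_inner_smul_left, PiLp.inner_apply]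
  simp [rowMap_apply, mul_comm]

theorem norm_rowMap_le {h : ℕ} (w : E h) : ‖rowMap w‖ ≤ ‖w‖ := by
  simp [rowMap]

/-- A comparator is the gradient-descent MLP map with the single row `W = (e_a - e_b)ᵀ` and unit
step size. As `‖W‖² = 2` for `a ≠ b`, this is the largest step size that is allowed. -/
theorem mlp_rowMap_eq_comparator {h : ℕ} (a b : Fin h) :
    mlp (rowMap (EuclideanSpace.single a (1 : ℝ) - EuclideanSpace.single b (1 : ℝ))) 0 1 =
      comparator a b := by
  funext x
  simp [mlp, comparator, relu, adjoint_rowMap, rowMap_apply, inner_sub_left,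
    EuclideanSpace.inner_single_left]

theorem norm_single_sub_single_sq {h : ℕ} {a b : Fin h} (hab : a ≠ b) :
    ‖(EuclideanSpace.single a (1 : ℝ) - EuclideanSpace.single b (1 : ℝ) : E h)‖ ^ 2 = 2 := by
  rw [@norm_sub_sq_real]
  simp [EuclideanSpace.inner_single_left, hab]
  norm_num

theorem continuous_comparator {h : ℕ} (a b : Fin h) : Continuous (comparator a b) := by
  unfold comparator
  fun_prop

/-- Compositions of comparators. -/
inductive ComparatorNet {h : ℕ} : (E h → E h) → Prop
  | id : ComparatorNet id
  | comp {a b : Fin h} {F : E h → E h} (hab : a ≠ b) (hF : ComparatorNet F) :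
      ComparatorNet (comparator a b ∘ F)

namespace ComparatorNet

theorem continuous {h : ℕ} {F : E h → E h} (hF : ComparatorNet F) : Continuous F := by
  induction hF with
  | id => exact continuous_id
  | comp _ _ ih => exact (continuous_comparator _ _).comp ih

theorem trans {h : ℕ} {F G : E h → E h} (hG : ComparatorNet G) (hF : ComparatorNet F) :
    ComparatorNet (G ∘ F) := by
  induction hG with
  | id => exact hF
  | comp hab _ ih => exact .comp hab ih

end ComparatorNet

/-! ### Lattice functions computed by comparator networks -/

/-- The function `f` depends only on the coordinates in `U`, and some comparator network that
acts only on the coordinates in `U` leaves its value in the coordinate `a ∈ U`. -/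
def Computes {h : ℕ} (U : Finset (Fin h)) (a : Fin h) (f : E h → ℝ) : Prop :=
  (∀ x y : E h, (∀ c ∈ U, x c = y c) → f x = f y) ∧ a ∈ U ∧
    ∃ F, ComparatorNet F ∧ (∀ x, F x a = f x) ∧ ∀ x, ∀ c ∉ U, F x c = x c

theorem computes_coord {h : ℕ} (a : Fin h) : Computes {a} a fun x => x a :=
  ⟨fun _ _ hxy => hxy a (by simp), by simp, _, .id, fun _ => rfl, fun _ _ _ => rfl⟩

theorem Computes.exists_min_max {h : ℕ} {U V : Finset (Fin h)} {a b : Fin h} {f g : E h → ℝ}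
    (hf : Computes U a f) (hg : Computes V b g) (hUV : Disjoint U V) :
    Computes (U ∪ V) a (fun x => min (f x) (g x)) ∧
      Computes (U ∪ V) b (fun x => max (f x) (g x)) := by
  obtain ⟨hfU, ha, F, hF, hFa, hFU⟩ := hf
  obtain ⟨hgV, hb, G, hG, hGb, hGV⟩ := hg
  have haV : a ∉ V := Finset.disjoint_left.1 hUV ha
  have hab : a ≠ b := fun h => haV (h ▸ hb)
  have h1 : ∀ x, G (F x) a = f x := fun x => by rw [hGV _ _ haV, hFa]
  have h2 : ∀ x, G (F x) b = g x := fun x => by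
    rw [hGb]
    exact hgV _ _ fun c hc => hFU _ _ (Finset.disjoint_right.1 hUV hc)
  have hloc : ∀ x y : E h, (∀ c ∈ U ∪ V, x c = y c) → f x = f y ∧ g x = g y := fun x y hxy =>
    ⟨hfU _ _ fun c hc => hxy c (Finset.mem_union_left _ hc),
      hgV _ _ fun c hc => hxy c (Finset.mem_union_right _ hc)⟩
  have hout : ∀ x, ∀ c ∉ U ∪ V, comparator a b (G (F x)) c = x c := fun x c hc => by
    rw [Finset.mem_union, not_or] at hc
    rw [comparator_of_ne (ne_of_mem_of_not_mem ha hc.1).symm (ne_of_mem_of_not_mem hb hc.2).symm,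
      hGV _ _ hc.2, hFU _ _ hc.1]
  refine ⟨⟨fun x y hxy => ?_, Finset.mem_union_left _ ha, _, .comp hab (hG.trans hF),
      fun x => ?_, hout⟩, ⟨fun x y hxy => ?_, Finset.mem_union_right _ hb, _,
      .comp hab (hG.trans hF), fun x => ?_, hout⟩⟩
  · simp only [(hloc x y hxy).1, (hloc x y hxy).2]
  · simp only [Function.comp, comparator_left hab, h1, h2]
  · simp only [(hloc x y hxy).1, (hloc x y hxy).2]
  · simp only [Function.comp, comparator_right hab, h1, h2]

theorem exists_computes_inf' {h : ℕ} {ι : Type*} [DecidableEq ι] {U : ι → Finset (Fin h)}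
    {a : ι → Fin h} {f : ι → E h → ℝ} (hf : ∀ i, Computes (U i) (a i) (f i))
    (hU : Pairwise fun i j => Disjoint (U i) (U j)) (s : Finset ι) (hs : s.Nonempty) :
    ∃ b, Computes (s.biUnion U) b fun x => s.inf' hs fun i => f i x := by
  induction hs using Finset.Nonempty.cons_induction with
  | singleton i => exact ⟨a i, by simpa using hf i⟩
  | cons i s hi hs ih =>
    obtain ⟨b, hb⟩ := ih
    refine ⟨a i, ?_⟩
    have := ((hf i).exists_min_max hb ?_).1
    · convert this using 2
      · simp
      · rw [Finset.inf'_cons hs]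
    · exact (Finset.disjoint_biUnion_right _ _ _).2 fun j hj => hU fun h => hi (h ▸ hj)

theorem exists_computes_sup' {h : ℕ} {ι : Type*} [DecidableEq ι] {U : ι → Finset (Fin h)}
    {a : ι → Fin h} {f : ι → E h → ℝ} (hf : ∀ i, Computes (U i) (a i) (f i))
    (hU : Pairwise fun i j => Disjoint (U i) (U j)) (s : Finset ι) (hs : s.Nonempty) :
    ∃ b, Computes (s.biUnion U) b fun x => s.sup' hs fun i => f i x := by
  induction hs using Finset.Nonempty.cons_induction with
  | singleton i => exact ⟨a i, by simpa using hf i⟩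
  | cons i s hi hs ih =>
    obtain ⟨b, hb⟩ := ih
    refine ⟨b, ?_⟩
    have := ((hf i).exists_min_max hb ?_).2
    · convert this using 2
      · simp
      · rw [Finset.sup'_cons hs]
    · exact (Finset.disjoint_biUnion_right _ _ _).2 fun j hj => hU fun h => hi (h ▸ hj)

/-- The maximum over the first index of the minima over the second index of a finite array. -/
noncomputable def maxMin {ι κ : Type*} [Fintype ι] [Nonempty ι] [Fintype κ] [Nonempty κ]
    (f : ι → κ → ℝ) : ℝ :=
  Finset.univ.sup' Finset.univ_nonempty fun i => Finset.univ.inf' Finset.univ_nonempty (f i)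

theorem exists_computes_maxMin {h : ℕ} {ι κ : Type*} [Fintype ι] [Nonempty ι] [Fintype κ]
    [Nonempty κ] (e : ι → κ → Fin h) (he : Function.Injective2 e) :
    ∃ b, Computes (Finset.univ.image fun p : ι × κ => e p.1 p.2) b
      fun x => maxMin fun i j => x (e i j) := by
  classical
  have h1 : ∀ i, ∃ b, Computes (Finset.univ.biUnion fun j : κ => {e i j}) b fun x =>
      Finset.univ.inf' Finset.univ_nonempty fun j => x (e i j) := fun i =>
    exists_computes_inf' (fun j => computes_coord (e i j))
      (fun j k hjk => by
        simpa using fun h => hjk (he h).2) Finset.univ Finset.univ_nonempty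
  choose a ha using h1
  obtain ⟨b, hb⟩ := exists_computes_sup' ha (fun i j hij => by
    simp only [Finset.disjoint_left, Finset.mem_biUnion, Finset.mem_univ, true_and,
      Finset.mem_singleton, not_exists, forall_exists_index]
    rintro c k rfl l h
    exact hij (he h).1) Finset.univ Finset.univ_nonempty
  refine ⟨b, ?_⟩
  unfold maxMin
  convert hb using 1
  ext c
  simp [eq_comm]

/-- Functions of disjoint sets of coordinates are computed simultaneously. -/
theorem exists_comparatorNet_forall {h : ℕ} {ι : Type*} [DecidableEq ι] {U : ι → Finset (Fin h)}
    {a : ι → Fin h} {f : ι → E h → ℝ} (hf : ∀ i, Computes (U i) (a i) (f i))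
    (hU : Pairwise fun i j => Disjoint (U i) (U j)) (s : Finset ι) :
    ∃ F, ComparatorNet F ∧ (∀ i ∈ s, ∀ x, F x (a i) = f i x) ∧
      ∀ c, (∀ i ∈ s, c ∉ U i) → ∀ x, F x c = x c := by
  induction s using Finset.induction_on with
  | empty => exact ⟨_, .id, by simp, fun _ _ _ => rfl⟩
  | insert i s hi ih =>
    obtain ⟨F, hF, hFa, hFU⟩ := ih
    obtain ⟨hfU, ha, G, hG, hGa, hGU⟩ := hf i
    have hne : ∀ j ∈ s, j ≠ i := fun j hj h => hi (h ▸ hj)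
    refine ⟨_, hG.trans hF, fun j hj x => ?_, fun c hc x => ?_⟩
    · rcases Finset.mem_insert.1 hj with rfl | hj
      · rw [Function.comp, hGa]
        exact hfU _ _ fun c hc => hFU _ (fun k hk =>
          Finset.disjoint_left.1 (hU (hne k hk).symm) hc) _
      · rw [Function.comp, hGU _ _ (Finset.disjoint_left.1 (hU (hne j hj)) (hf j).2.1), hFa j hj]
    · rw [Function.comp, hGU _ _ (hc i (Finset.mem_insert_self _ _)),
        hFU _ fun j hj => hc j (Finset.mem_insert_of_mem hj)]

/-! ### Trivial layers and attention without scores -/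

theorem attention_zero {h : ℕ} (A : E h →L[ℝ] E h) (μ : ProbabilityMeasure (E h)) :
    attention A 0 μ = id := by
  funext x
  simp [attention]

theorem map_eq_self_of_eq_id {h : ℕ} (μ : ProbabilityMeasure (E h)) {f : E h → E h}
    (hf : AEMeasurable f (μ : Measure (E h))) (h1 : f = id) : μ.map hf = μ := by
  subst h1
  exact Subtype.ext Measure.map_id

/-- The identity as an attention layer. -/
def idAttentionLayer {h : ℕ} (Ω : Set (E h)) : AttentionLayer h Ω Ω where
  A := 0
  η := 0
  step_nonneg := le_rfl
  step_le := by simp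
  mapsTo := fun μ _ x hx => by rwa [attention_zero]

theorem idAttentionLayer_bar {h : ℕ} (Ω : Set (E h)) (p : ProbabilityMeasure (E h) × E h) :
    (idAttentionLayer Ω).bar p = p :=
  Prod.ext (map_eq_self_of_eq_id _ (measurable_attention _ _ _).aemeasurable (attention_zero _ _))
    (congrFun (attention_zero _ _) _)

/-- The identity as an MLP layer, with no hidden neurons. -/
def idMLPLayer {h : ℕ} (Ω : Set (E h)) : MLPLayer h Ω Ω where
  k := 0
  W := 0
  b := 0
  τ := 0
  step_nonneg := le_rfl
  step_le := by simp
  mapsTo := fun x hx => by simpa [mlp] using hx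

theorem probabilityMeasure_map_congr {h : ℕ} (μ : ProbabilityMeasure (E h)) {f g : E h → E h}
    (hf : AEMeasurable f (μ : Measure (E h))) (hg : AEMeasurable g (μ : Measure (E h)))
    (hfg : f = g) : μ.map hf = μ.map hg := by
  subst hfg
  rfl

theorem probabilityMeasure_map_map {d h k : ℕ} (μ : ProbabilityMeasure (E d)) {f : E d → E h}
    {g : E h → E k} (hf : Measurable f) (hg : Measurable g) :
    (μ.map hf.aemeasurable).map hg.aemeasurable = μ.map (hg.comp hf).aemeasurable :=
  Subtype.ext (Measure.map_map hg hf)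

/-- Interleaving a comparator network with trivial attention layers, one may append it to a
composition of layers. -/
theorem ComparatorNet.exists_composition {h L : ℕ}
    {S : ProbabilityMeasure (E h) × E h → ProbabilityMeasure (E h) × E h} {Ω Ω' : Set (E h)}
    (hΩ' : IsCompact Ω') {F : E h → E h} (hF : ComparatorNet F) (hS : Composition Ω L S Ω') :
    ∃ L' S', L ≤ L' ∧ Composition Ω L' S' (F '' Ω') ∧
      ∀ p, S' p = ((S p).1.map hF.continuous.measurable.aemeasurable, F (S p).2) := by
  induction hF with
  | id =>
    refine ⟨L, S, le_rfl, by simpa using hS, fun p => ?_⟩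
    rw [map_eq_self_of_eq_id _ _ rfl]
    rfl
  | @comp a b F hab hF ih =>
    obtain ⟨L', S', hL, hS', hp⟩ := ih
    have hc := hΩ'.image hF.continuous
    let M : MLPLayer h (F '' Ω') ((comparator a b ∘ F) '' Ω') :=
      { k := 1
        W := rowMap (EuclideanSpace.single a (1 : ℝ) - EuclideanSpace.single b (1 : ℝ))
        b := 0
        τ := 1
        step_nonneg := zero_le_one
        step_le := by
          rw [one_mul, ← norm_single_sub_single_sq hab]
          gcongr
          exact norm_rowMap_le _
        mapsTo := by
          rintro _ ⟨x, hx, rfl⟩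
          rw [mlp_rowMap_eq_comparator]
          exact ⟨x, hx, rfl⟩ }
    refine ⟨L' + 1, _, hL.trans (Nat.le_succ _), hS'.layer hc
      (hΩ'.image (ComparatorNet.comp hab hF).continuous) (idAttentionLayer _) M, fun p => ?_⟩
    change M.bar ((idAttentionLayer _).bar (S' p)) = _
    rw [idAttentionLayer_bar, hp]
    refine Prod.ext ?_ (by simp only [MLPLayer.bar, M, mlp_rowMap_eq_comparator]; rfl)
    refine (probabilityMeasure_map_congr _ (measurable_mlp _ _ _).aemeasurable
      (continuous_comparator a b).measurable.aemeasurable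
      (mlp_rowMap_eq_comparator a b)).trans ?_
    exact probabilityMeasure_map_map _ hF.continuous.measurable
      (continuous_comparator a b).measurable

/-- When the query is orthogonal to all keys, attention is plain averaging over the context. -/
theorem attention_of_inner_eq_zero {h : ℕ} (A : E h →L[ℝ] E h) (η : ℝ)
    (μ : ProbabilityMeasure (E h)) (x : E h) (hx : ∀ y, inner ℝ x (A y) = 0) :
    attention A η μ x = x - η • ∫ y, A y ∂(μ : Measure (E h)) := by
  simp [attention, hx]

/-! ### Kantorovich-Rubinstein duality -/

/-- Finite Kantorovich-Rubinstein duality, as an alternative: for marginals `m`, `n` on a finite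
space with ground cost `D`, there is a coupling of cost at most `r`, or a `1`-Lipschitz function
shows that every coupling costs more than `r`. -/
theorem discrete_kantorovich {ι : Type*} [Fintype ι] [Nonempty ι] {D : ι → ι → ℝ}
    (hD0 : ∀ i, D i i = 0) (hD : ∀ i j k, D i k ≤ D i j + D j k) {m n : ι → ℝ}
    (hm0 : ∀ i, 0 ≤ m i) (hm : ∑ i, m i = 1) (hn0 : ∀ i, 0 ≤ n i) (hn : ∑ i, n i = 1) (r : ℝ) :
    (∃ π : ι × ι → ℝ, (∀ p, 0 ≤ π p) ∧ (∀ i, ∑ j, π (i, j) = m i) ∧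
      (∀ j, ∑ i, π (i, j) = n j) ∧ ∑ p, π p * D p.1 p.2 ≤ r) ∨
    ∃ θ : ι → ℝ, (∀ i j, θ i - θ j ≤ D i j) ∧ r < ∑ i, θ i * m i - ∑ i, θ i * n i := by
  classical
  by_contra! hcon
  obtain ⟨h1, h2⟩ := hcon
  -- The triples (first marginal, second marginal, cost) of probability weights form a compact
  -- convex set, which is disjoint from the closed ray of the forbidden triples.
  let T : (ι × ι → ℝ) →ₗ[ℝ] (ι → ℝ) × (ι → ℝ) × ℝ :=
    { toFun := fun π => (fun i => ∑ j, π (i, j), fun j => ∑ i, π (i, j), ∑ p, π p * D p.1 p.2)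
      map_add' := fun a b => by
        ext <;> simp [Finset.sum_add_distrib, add_mul]
      map_smul' := fun a b => by
        ext <;> simp [Finset.mul_sum, mul_assoc] }
  have hT : Continuous T := T.continuous_of_finiteDimensional
  let R : Set ((ι → ℝ) × (ι → ℝ) × ℝ) := {m} ×ˢ {n} ×ˢ Set.Iic r
  obtain ⟨f, u, v, hf, huv, hv⟩ := geometric_hahn_banach_compact_closed
    (s := T '' stdSimplex ℝ (ι × ι)) (t := R)
    ((convex_stdSimplex ℝ _).linear_image T) ((isCompact_stdSimplex ℝ _).image hT)
    ((convex_singleton _).prod ((convex_singleton _).prod (convex_Iic r)))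
    (isClosed_singleton.prod (isClosed_singleton.prod isClosed_Iic)) (by
      rw [Set.disjoint_left]
      rintro _ ⟨π, hπ, rfl⟩ ⟨ha, hb, hc⟩
      exact absurd hc (not_le.2 (h1 π hπ.1 (congrFun ha) (congrFun hb))))
  set φ : ι → ℝ := fun i => f (Pi.single i 1, 0, 0) with hφ
  set ψ : ι → ℝ := fun i => f (0, Pi.single i 1, 0) with hψ
  set κ : ℝ := - f (0, 0, 1) with hκ
  have hfe : ∀ a b c, f (a, b, c) = ∑ i, φ i * a i + ∑ i, ψ i * b i - κ * c := by
    intro a b c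
    have e1 : (a, b, c) = ∑ i, a i • ((Pi.single i 1, 0, 0) : (ι → ℝ) × (ι → ℝ) × ℝ) +
        ∑ i, b i • ((0, Pi.single i 1, 0) : (ι → ℝ) × (ι → ℝ) × ℝ) +
        c • ((0, 0, 1) : (ι → ℝ) × (ι → ℝ) × ℝ) := by
      refine Prod.ext ?_ (Prod.ext ?_ ?_)
      · ext k
        simp [Prod.fst_sum, Finset.sum_apply, Pi.single_apply]
      · ext k
        simp [Prod.fst_sum, Prod.snd_sum, Finset.sum_apply, Pi.single_apply]
      · simp [Prod.snd_sum]
    rw [e1]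
    simp only [map_add, map_sum, map_smul, smul_eq_mul]
    simp only [hφ, hψ, hκ, mul_comm]
    ring
  have hcell : ∀ i j, φ i + ψ j - κ * D i j < u := by
    intro i j
    have h3 := hf (T (Pi.single (i, j) 1)) ⟨_, single_mem_stdSimplex ℝ _, rfl⟩
    have e2 : T (Pi.single (i, j) 1) = (Pi.single i 1, Pi.single j 1, D i j) := by
      refine Prod.ext ?_ (Prod.ext ?_ ?_)
      · ext k
        simp only [T, LinearMap.coe_mk, AddHom.coe_mk, Pi.single_apply, Prod.mk.injEq]
        by_cases hk : k = i <;> simp [hk]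
      · ext k
        simp only [T, LinearMap.coe_mk, AddHom.coe_mk, Pi.single_apply, Prod.mk.injEq]
        by_cases hk : k = j <;> simp [hk]
      · simp [T, Pi.single_apply]
    rw [e2, hfe] at h3
    simpa [Pi.single_apply] using h3
  have hray : ∀ s ≤ r, v < ∑ i, φ i * m i + ∑ i, ψ i * n i - κ * s := by
    intro s hs
    rw [← hfe]
    exact hv _ ⟨rfl, rfl, hs⟩
  -- The ray is unbounded below in the cost.
  have hκ0 : 0 ≤ κ := by
    by_contra! hneg
    set c := ∑ i, φ i * m i + ∑ i, ψ i * n i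
    have h3 := hray (min r ((c - v) / κ)) (min_le_left _ _)
    have h4 : κ * ((c - v) / κ) = c - v := by
      have := hneg.ne
      field_simp
    have h5 : κ * ((c - v) / κ) ≤ κ * min r ((c - v) / κ) :=
      mul_le_mul_of_nonpos_left (min_le_right _ _) hneg.le
    linarith
  -- The `c`-transform of `ψ`.
  let θ : ι → ℝ := fun i => Finset.univ.inf' Finset.univ_nonempty fun j => κ * D i j - ψ j
  have hθle : ∀ i j, θ i ≤ κ * D i j - ψ j := fun i j => Finset.inf'_le _ (Finset.mem_univ j)
  have hθlip : ∀ i k, θ i - θ k ≤ κ * D i k := by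
    intro i k
    have h3 : θ i - κ * D i k ≤ θ k := Finset.le_inf' _ _ fun j _ => by
      have := hθle i j
      have := mul_le_mul_of_nonneg_left (hD i k j) hκ0
      linarith
    linarith
  have hθφ : ∀ i, φ i - u ≤ θ i := fun i => Finset.le_inf' _ _ fun j _ => by
    linarith [hcell i j]
  have hgap : κ * r < ∑ i, θ i * m i - ∑ i, θ i * n i := by
    have h3 : ∑ i, (φ i - u) * m i ≤ ∑ i, θ i * m i :=
      Finset.sum_le_sum fun i _ => mul_le_mul_of_nonneg_right (hθφ i) (hm0 i)
    have h4 : ∑ i, θ i * n i ≤ ∑ i, - ψ i * n i :=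
      Finset.sum_le_sum fun i _ => mul_le_mul_of_nonneg_right
        (by simpa [hD0] using hθle i i) (hn0 i)
    have h5 := hray r le_rfl
    simp only [sub_mul, Finset.sum_sub_distrib, ← Finset.mul_sum, hm, neg_mul,
      Finset.sum_neg_distrib] at h3 h4
    linarith
  -- For `κ = 0` the potential `θ` is constant; otherwise `θ / κ` is `1`-Lipschitz.
  rcases hκ0.eq_or_lt with h0 | hpos
  · obtain ⟨i₀⟩ := ‹Nonempty ι›
    have hconst : ∀ i, θ i = θ i₀ := fun i => by
      have h3 := hθlip i i₀
      have h4 := hθlip i₀ i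
      rw [← h0, zero_mul] at h3 h4
      linarith
    simp only [hconst, ← Finset.mul_sum, hm, hn, ← h0] at hgap
    linarith
  · have h3 := h2 (fun i => θ i / κ) fun i j => by
      rw [← sub_div, div_le_iff₀ hpos, mul_comm]
      exact hθlip i j
    simp only [div_mul_eq_mul_div, ← Finset.sum_div] at h3
    rw [← sub_div, div_le_iff₀ hpos] at h3
    linarith

theorem ae_mem_of_mem_prob {d : ℕ} {Ω : Set (E d)} {μ : ProbabilityMeasure (E d)}
    (hμ : μ ∈ Prob Ω) : ∀ᵐ x ∂(μ : Measure (E d)), x ∈ Ω := hμ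

theorem integrable_of_mem_prob {d : ℕ} {Ω : Set (E d)} (hΩ : IsCompact Ω)
    {μ : ProbabilityMeasure (E d)} (hμ : μ ∈ Prob Ω) {F : Type*} [NormedAddCommGroup F]
    [SecondCountableTopology F] {f : E d → F} (hf : Continuous f) :
    Integrable f (μ : Measure (E d)) := by
  obtain ⟨B, hB⟩ := hΩ.exists_bound_of_continuousOn hf.continuousOn
  exact Integrable.of_bound hf.aestronglyMeasurable B
    ((ae_mem_of_mem_prob hμ).mono fun x hx => hB x hx)

/-- A compact set is covered by finitely many measurable cells of radius `δ`: `P x` is the index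
of the cell of `x`, and `c i` is the centre of the `i`-th cell. -/
theorem exists_cells {d : ℕ} {Ω : Set (E d)} (hΩ : IsCompact Ω) (hne : Ω.Nonempty) {δ : ℝ}
    (hδ : 0 < δ) : ∃ (N : ℕ) (c : Fin (N + 1) → E d) (P : E d → Fin (N + 1)), Measurable P ∧
      (∀ i, c i ∈ Ω) ∧ ∀ x ∈ Ω, dist x (c (P x)) ≤ δ := by
  obtain ⟨t, htΩ, htf, hcov⟩ := hΩ.finite_cover_balls hδ
  have htne : t.Nonempty := by
    obtain ⟨x, hx⟩ := hne
    obtain ⟨y, hy, -⟩ := Set.mem_iUnion₂.1 (hcov hx)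
    exact ⟨y, hy⟩
  obtain ⟨e, rfl⟩ := htf.countable.exists_eq_range htne
  obtain ⟨N, hN⟩ : ∃ N, ∀ y ∈ Set.range e, ∃ k ≤ N, e k = y := by
    choose! g hg using fun y (hy : y ∈ Set.range e) => hy
    obtain ⟨N, hN⟩ := (htf.image g).bddAbove
    exact ⟨N, fun y hy => ⟨g y, hN ⟨y, hy, rfl⟩, hg y hy⟩⟩
  refine ⟨N, fun i => e i, fun x => ⟨SimpleFunc.nearestPtInd e N x,
    Nat.lt_succ_of_le (SimpleFunc.nearestPtInd_le e N x)⟩, ?_, fun i => htΩ ⟨_, rfl⟩,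
    fun x hx => ?_⟩
  · refine measurable_to_countable' fun i => ?_
    convert (SimpleFunc.nearestPtInd e N).measurableSet_fiber i using 1
    ext x
    simp [Fin.ext_iff]
  · obtain ⟨y, hy, hxy⟩ := Set.mem_iUnion₂.1 (hcov hx)
    obtain ⟨k, hk, rfl⟩ := hN y hy
    have h1 := SimpleFunc.edist_nearestPt_le e x hk
    rw [edist_dist, edist_dist, ENNReal.ofReal_le_ofReal_iff dist_nonneg] at h1
    rw [dist_comm]
    rw [Metric.mem_ball, dist_comm] at hxy
    exact h1.trans hxy.le

theorem integral_comp_eq_sum {d N : ℕ} (μ : ProbabilityMeasure (E d)) {P : E d → Fin N}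
    (hP : Measurable P) (θ : Fin N → ℝ) :
    ∫ x, θ (P x) ∂(μ : Measure (E d)) = ∑ i, θ i * (μ : Measure (E d)).real (P ⁻¹' {i}) := by
  have : IsFiniteMeasure ((μ : Measure (E d)).map P) := inferInstance
  rw [← integral_map (f := θ) hP.aemeasurable (by fun_prop),
    integral_fintype (Integrable.of_finite)]
  simp [map_measureReal_apply hP, mul_comm]

theorem integrable_comp_of_finite {d N : ℕ} {μ : ProbabilityMeasure (E d)} {P : E d → Fin N}
    (hP : Measurable P) {θ : Fin N → ℝ} : Integrable (fun x => θ (P x)) (μ : Measure (E d)) :=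
  Integrable.comp_measurable (g := θ) Integrable.of_finite hP

theorem abs_integral_sub_sum_le {d N : ℕ} {Ω : Set (E d)} (hΩ : IsCompact Ω)
    {μ : ProbabilityMeasure (E d)} (hμ : μ ∈ Prob Ω) {P : E d → Fin N} {c : Fin N → E d}
    (hP : Measurable P) {δ : ℝ} (hc : ∀ x ∈ Ω, dist x (c (P x)) ≤ δ) {φ : E d → ℝ}
    (hφ : LipschitzWith 1 φ) :
    |∫ x, φ x ∂(μ : Measure (E d)) - ∑ i, φ (c i) * (μ : Measure (E d)).real (P ⁻¹' {i})| ≤ δ := by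
  rw [← integral_comp_eq_sum μ hP (fun i => φ (c i)), ← integral_sub
    (integrable_of_mem_prob hΩ hμ hφ.continuous)
    (integrable_comp_of_finite hP (θ := fun i => φ (c i)))]
  have h1 : ∀ᵐ x ∂(μ : Measure (E d)), ‖φ x - φ (c (P x))‖ ≤ δ := by
    filter_upwards [ae_mem_of_mem_prob hμ] with x hx
    have := hφ.dist_le_mul x (c (P x))
    rw [NNReal.coe_one, one_mul] at this
    exact this.trans (hc x hx)
  simpa using norm_integral_le_of_norm_le_const h1

theorem sum_measureReal_preimage {d N : ℕ} (μ : ProbabilityMeasure (E d)) {P : E d → Fin N}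
    (hP : Measurable P) : ∑ i, (μ : Measure (E d)).real (P ⁻¹' {i}) = 1 := by
  simpa using (integral_comp_eq_sum μ hP fun _ => 1).symm

open scoped ENNReal ProbabilityTheory in
/-- A coupling of the cell masses lifts to a coupling of the measures: on a product of two cells,
take the product of the conditioned measures. -/
theorem exists_isCoupling_of_cells {d N : ℕ} {Ω : Set (E d)} {μ ν : ProbabilityMeasure (E d)}
    (hμ : μ ∈ Prob Ω) (hν : ν ∈ Prob Ω) {P : E d → Fin N} {c : Fin N → E d}
    (hP : Measurable P) {δ : ℝ} (hδ : 0 ≤ δ) (hc : ∀ x ∈ Ω, dist x (c (P x)) ≤ δ)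
    {π : Fin N × Fin N → ℝ} (hπ0 : ∀ p, 0 ≤ π p)
    (hπμ : ∀ i, ∑ j, π (i, j) = (μ : Measure (E d)).real (P ⁻¹' {i}))
    (hπν : ∀ j, ∑ i, π (i, j) = (ν : Measure (E d)).real (P ⁻¹' {j})) :
    W₁ μ ν ≤ ENNReal.ofReal (∑ p, π p * dist (c p.1) (c p.2) + 2 * δ) := by
  have hPm : ∀ i, MeasurableSet (P ⁻¹' {i}) := fun i => hP (measurableSet_singleton i)
  have hcond : ∀ (ρ : ProbabilityMeasure (E d)) i,
      ENNReal.ofReal ((ρ : Measure (E d)).real (P ⁻¹' {i})) • (ρ : Measure (E d))[|P ⁻¹' {i}] =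
        (ρ : Measure (E d)).restrict (P ⁻¹' {i}) := by
    intro ρ i
    rw [ofReal_measureReal, ProbabilityTheory.cond, smul_smul]
    by_cases h0 : (ρ : Measure (E d)) (P ⁻¹' {i}) = 0
    · rw [Measure.restrict_eq_zero.2 h0, smul_zero]
    · rw [ENNReal.mul_inv_cancel h0 (measure_ne_top _ _), one_smul]
  have hcond1 : ∀ (ρ : ProbabilityMeasure (E d)) i (t : ℝ),
      ((ρ : Measure (E d)).real (P ⁻¹' {i}) = 0 → t = 0) →
      ENNReal.ofReal t * (ρ : Measure (E d))[|P ⁻¹' {i}] Set.univ = ENNReal.ofReal t := by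
    intro ρ i t ht
    by_cases h0 : (ρ : Measure (E d)) (P ⁻¹' {i}) = 0
    · rw [ht (by simp [Measure.real, h0])]
      simp
    · have := ProbabilityTheory.cond_isProbabilityMeasure h0
      rw [measure_univ, mul_one]
  have hsum : ∀ ρ : ProbabilityMeasure (E d),
      ∑ i, (ρ : Measure (E d)).restrict (P ⁻¹' {i}) = (ρ : Measure (E d)) := by
    intro ρ
    rw [← Measure.sum_fintype, ← Measure.restrict_iUnion (fun i j hij => by
      simpa using (Set.disjoint_singleton.2 hij).preimage P) hPm]
    convert Measure.restrict_univ
    ext x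
    simp
  have hz1 : ∀ i j, (μ : Measure (E d)).real (P ⁻¹' {i}) = 0 → π (i, j) = 0 := fun i j h =>
    (Finset.sum_eq_zero_iff_of_nonneg fun k _ => hπ0 (i, k)).1 ((hπμ i).trans h) j
      (Finset.mem_univ j)
  have hz2 : ∀ i j, (ν : Measure (E d)).real (P ⁻¹' {j}) = 0 → π (i, j) = 0 := fun i j h =>
    (Finset.sum_eq_zero_iff_of_nonneg fun k _ => hπ0 (k, j)).1 ((hπν j).trans h) i
      (Finset.mem_univ i)
  let κ : Fin N → Fin N → Measure (E d × E d) := fun i j =>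
    (μ : Measure (E d))[|P ⁻¹' {i}].prod (ν : Measure (E d))[|P ⁻¹' {j}]
  let ρ : Measure (E d × E d) := ∑ i, ∑ j, ENNReal.ofReal (π (i, j)) • κ i j
  have hρ : IsCoupling ρ μ ν := by
    constructor
    · calc ρ.map Prod.fst
          = ∑ i, ∑ j, ENNReal.ofReal (π (i, j)) • (μ : Measure (E d))[|P ⁻¹' {i}] := by
            simp only [ρ, κ, ← Measure.mapₗ_apply_of_measurable measurable_fst, map_sum, map_smul]
            refine Finset.sum_congr rfl fun i _ => Finset.sum_congr rfl fun j _ => ?_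
            rw [Measure.mapₗ_apply_of_measurable measurable_fst, Measure.map_fst_prod, smul_smul,
              hcond1 _ _ _ (hz2 i j)]
        _ = μ := by
            conv_rhs => rw [← hsum μ]
            refine Finset.sum_congr rfl fun i _ => ?_
            rw [← Finset.sum_smul, ← ENNReal.ofReal_sum_of_nonneg fun j _ => hπ0 (i, j), hπμ,
              hcond]
    · calc ρ.map Prod.snd
          = ∑ i, ∑ j, ENNReal.ofReal (π (i, j)) • (ν : Measure (E d))[|P ⁻¹' {j}] := by
            simp only [ρ, κ, ← Measure.mapₗ_apply_of_measurable measurable_snd, map_sum, map_smul]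
            refine Finset.sum_congr rfl fun i _ => Finset.sum_congr rfl fun j _ => ?_
            rw [Measure.mapₗ_apply_of_measurable measurable_snd, Measure.map_snd_prod, smul_smul,
              hcond1 _ _ _ (hz1 i j)]
        _ = ν := by
            conv_rhs => rw [← hsum ν]
            rw [Finset.sum_comm]
            refine Finset.sum_congr rfl fun j _ => ?_
            rw [← Finset.sum_smul, ← ENNReal.ofReal_sum_of_nonneg fun i _ => hπ0 (i, j), hπν,
              hcond]
  have hcell : ∀ (ρ : ProbabilityMeasure (E d)), ρ ∈ Prob Ω → ∀ i,
      ∀ᵐ x ∂(ρ : Measure (E d))[|P ⁻¹' {i}], dist x (c i) ≤ δ := by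
    intro ρ hρ i
    have h1 := ProbabilityTheory.ae_cond_mem (μ := (ρ : Measure (E d))) (hPm i)
    have h2 := (ProbabilityTheory.cond_absolutelyContinuous
      (μ := (ρ : Measure (E d))) (s := P ⁻¹' {i})).ae_le (ae_mem_of_mem_prob hρ)
    filter_upwards [h1, h2] with x hx hxΩ
    have := hc x hxΩ
    rwa [hx] at this
  have hcost : ∀ i j, ∫⁻ p, edist p.1 p.2 ∂κ i j ≤
      ENNReal.ofReal (dist (c i) (c j) + 2 * δ) * κ i j Set.univ := by
    intro i j
    rw [← lintegral_const]
    refine lintegral_mono_ae ?_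
    filter_upwards [Measure.quasiMeasurePreserving_fst.ae (hcell μ hμ i),
      Measure.quasiMeasurePreserving_snd.ae (hcell ν hν j)] with p h1 h2
    rw [edist_dist]
    refine ENNReal.ofReal_le_ofReal ?_
    have := dist_triangle4 p.1 (c i) (c j) p.2
    rw [dist_comm] at h2
    linarith
  have htot : ∑ p : Fin N × Fin N, π p = 1 := by
    rw [Fintype.sum_prod_type]
    simp only [hπμ]
    exact sum_measureReal_preimage μ hP
  calc W₁ μ ν ≤ ∫⁻ p, edist p.1 p.2 ∂ρ := iInf₂_le ρ hρ
    _ = ∑ i, ∑ j, ENNReal.ofReal (π (i, j)) * ∫⁻ p, edist p.1 p.2 ∂κ i j := by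
        simp only [ρ, lintegral_finsetSum_measure, lintegral_smul_measure, smul_eq_mul]
    _ ≤ ∑ i, ∑ j, ENNReal.ofReal (π (i, j) * (dist (c i) (c j) + 2 * δ)) := by
        refine Finset.sum_le_sum fun i _ => Finset.sum_le_sum fun j _ => ?_
        rw [ENNReal.ofReal_mul (hπ0 _)]
        refine (mul_le_mul_right (hcost i j) _).trans (le_of_eq ?_)
        rw [← Set.univ_prod_univ, Measure.prod_prod]
        nth_rewrite 2 [← hcond1 _ _ _ (hz2 i j), ← hcond1 _ _ _ (hz1 i j)]
        ring
    _ = ENNReal.ofReal (∑ p, π p * dist (c p.1) (c p.2) + 2 * δ) := by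
        rw [← Fintype.sum_prod_type', ← ENNReal.ofReal_sum_of_nonneg fun p _ =>
          mul_nonneg (hπ0 _) (by positivity)]
        simp only [mul_add, Finset.sum_add_distrib, ← Finset.sum_mul, htot, one_mul]

theorem W₁_ne_top {d : ℕ} {Ω : Set (E d)} (hΩ : IsCompact Ω) {μ ν : ProbabilityMeasure (E d)}
    (hμ : μ ∈ Prob Ω) (hν : ν ∈ Prob Ω) : W₁ μ ν ≠ ⊤ := by
  have h1 : W₁ μ ν ≤ Metric.ediam Ω := by
    refine (iInf₂_le ((μ : Measure (E d)).prod (ν : Measure (E d)))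
      ⟨by simp [Measure.map_fst_prod], by simp [Measure.map_snd_prod]⟩).trans ?_
    calc _ ≤ ∫⁻ _, Metric.ediam Ω ∂((μ : Measure (E d)).prod (ν : Measure (E d))) := by
          refine lintegral_mono_ae ?_
          filter_upwards [Measure.quasiMeasurePreserving_fst.ae (ae_mem_of_mem_prob hμ),
            Measure.quasiMeasurePreserving_snd.ae (ae_mem_of_mem_prob hν)] with p h1 h2
          exact Metric.edist_le_ediam_of_mem h1 h2
      _ = _ := by simp
  exact ne_top_of_le_ne_top hΩ.isBounded.ediam_ne_top h1

/-- The easy half of Kantorovich-Rubinstein duality. -/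
theorem abs_integral_sub_integral_le {d : ℕ} {Ω : Set (E d)} (hΩ : IsCompact Ω)
    {μ ν : ProbabilityMeasure (E d)} (hμ : μ ∈ Prob Ω) (hν : ν ∈ Prob Ω) {φ : E d → ℝ}
    (hφ : LipschitzWith 1 φ) :
    |∫ x, φ x ∂(μ : Measure (E d)) - ∫ x, φ x ∂(ν : Measure (E d))| ≤ (W₁ μ ν).toReal := by
  rw [← ENNReal.ofReal_le_iff_le_toReal (W₁_ne_top hΩ hμ hν)]
  refine le_iInf₂ fun π hπ => ?_
  have h1 : ∫ x, φ x ∂(μ : Measure (E d)) = ∫ p, φ p.1 ∂π := by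
    rw [← hπ.1, integral_map measurable_fst.aemeasurable hφ.continuous.aestronglyMeasurable]
  have h2 : ∫ x, φ x ∂(ν : Measure (E d)) = ∫ p, φ p.2 ∂π := by
    rw [← hπ.2, integral_map measurable_snd.aemeasurable hφ.continuous.aestronglyMeasurable]
  have i1 : Integrable (fun p : E d × E d => φ p.1) π := by
    have := integrable_of_mem_prob hΩ hμ hφ.continuous
    rw [← hπ.1] at this
    exact this.comp_measurable measurable_fst
  have i2 : Integrable (fun p : E d × E d => φ p.2) π := by
    have := integrable_of_mem_prob hΩ hν hφ.continuous
    rw [← hπ.2] at this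
    exact this.comp_measurable measurable_snd
  rw [h1, h2, ← integral_sub i1 i2, ← Real.norm_eq_abs, ofReal_norm]
  refine (enorm_integral_le_lintegral_enorm _).trans (lintegral_mono fun p => ?_)
  rw [← edist_eq_enorm_sub]
  simpa using hφ p.1 p.2

/-- The hard half of Kantorovich-Rubinstein duality, up to an error `δ`. -/
theorem exists_lipschitz_W₁_le {d : ℕ} {Ω : Set (E d)} (hΩ : IsCompact Ω)
    {μ ν : ProbabilityMeasure (E d)} (hμ : μ ∈ Prob Ω) (hν : ν ∈ Prob Ω) {δ : ℝ} (hδ : 0 < δ) :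
    ∃ φ : E d → ℝ, LipschitzWith 1 φ ∧
      (W₁ μ ν).toReal ≤ ∫ x, φ x ∂(μ : Measure (E d)) - ∫ x, φ x ∂(ν : Measure (E d)) + δ := by
  have hne : Ω.Nonempty := (ae_mem_of_mem_prob hμ).exists
  obtain ⟨N, c, P, hP, -, hc⟩ := exists_cells hΩ hne (show 0 < δ / 5 by positivity)
  rcases discrete_kantorovich (D := fun i j => dist (c i) (c j)) (fun i => dist_self _)
    (fun i j k => dist_triangle _ _ _) (fun i => measureReal_nonneg)
    (sum_measureReal_preimage μ hP) (fun i => measureReal_nonneg)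
    (sum_measureReal_preimage ν hP) ((W₁ μ ν).toReal - 3 * (δ / 5)) with
    ⟨π, hπ0, hπμ, hπν, hr⟩ | ⟨θ, hθ, hr⟩
  · exfalso
    have h1 := exists_isCoupling_of_cells hμ hν hP (by positivity) hc hπ0 hπμ hπν
    have h2 : 0 ≤ ∑ p, π p * dist (c p.1) (c p.2) :=
      Finset.sum_nonneg fun p _ => mul_nonneg (hπ0 p) dist_nonneg
    have h3 := ENNReal.toReal_le_of_le_ofReal (by positivity) h1
    linarith
  · -- McShane extension of the dual potential from the centres of the cells.
    let φ : E d → ℝ := fun x => Finset.univ.inf' Finset.univ_nonempty fun i => θ i + dist x (c i)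
    have hφle : ∀ x i, φ x ≤ θ i + dist x (c i) := fun x i =>
      Finset.inf'_le _ (Finset.mem_univ i)
    have hφc : ∀ i, φ (c i) = θ i := fun i => le_antisymm (by simpa using hφle (c i) i)
      (Finset.le_inf' _ _ fun j _ => by linarith [hθ i j])
    have hφ : LipschitzWith 1 φ := LipschitzWith.of_le_add fun x y => by
      have : φ x - dist x y ≤ φ y := Finset.le_inf' _ _ fun i _ => by
        linarith [hφle x i, dist_triangle x y (c i)]
      linarith
    have h1 := abs_integral_sub_sum_le hΩ hμ hP hc hφ
    have h2 := abs_integral_sub_sum_le hΩ hν hP hc hφ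
    simp only [hφc] at h1 h2
    rw [abs_le] at h1 h2
    exact ⟨φ, hφ, by linarith⟩

/-- `𝒫(Ω)` is totally bounded with respect to `W₁`. -/
theorem exists_finite_W₁_net {d : ℕ} {Ω : Set (E d)} (hΩ : IsCompact Ω) {δ : ℝ} (hδ : 0 < δ) :
    ∃ t : Set (Prob Ω), t.Finite ∧ ∀ μ : Prob Ω, ∃ ν ∈ t, (W₁ μ.1 ν.1).toReal ≤ δ := by
  rcases isEmpty_or_nonempty (Prob Ω) with h0 | h0
  · exact ⟨∅, Set.finite_empty, fun μ => isEmptyElim μ⟩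
  have hne : Ω.Nonempty := (ae_mem_of_mem_prob h0.some.2).exists
  obtain ⟨N, c, P, hP, hcΩ, hc⟩ := exists_cells hΩ hne (show 0 < δ / 4 by positivity)
  let m : Prob Ω → Fin (N + 1) → ℝ := fun μ i => (μ.1 : Measure (E d)).real (P ⁻¹' {i})
  have hm : TotallyBounded (Set.range m) := by
    refine TotallyBounded.subset ?_
      (isCompact_Icc (a := (0 : Fin (N + 1) → ℝ)) (b := 1)).totallyBounded
    rintro _ ⟨μ, rfl⟩
    exact ⟨fun i => measureReal_nonneg, fun i => measureReal_le_one⟩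
  set R := Metric.diam Ω
  have hR0 : 0 ≤ R := Metric.diam_nonneg
  obtain ⟨t, htm, htf, ht⟩ := Metric.finite_approx_of_totallyBounded hm
    (δ / (4 * (N + 1) * (R + 1))) (by positivity)
  choose! g hg using fun y (hy : y ∈ t) => htm hy
  refine ⟨g '' t, htf.image g, fun μ => ?_⟩
  obtain ⟨y, hy, hμy⟩ := Set.mem_iUnion₂.1 (ht ⟨μ, rfl⟩)
  refine ⟨g y, ⟨y, hy, rfl⟩, ?_⟩
  rw [← hg y hy, Metric.mem_ball] at hμy
  obtain ⟨φ, hφ, hle⟩ := exists_lipschitz_W₁_le hΩ μ.2 (g y).2 (show 0 < δ / 4 by positivity)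
  have h1 := abs_integral_sub_sum_le hΩ μ.2 hP hc hφ
  have h2 := abs_integral_sub_sum_le hΩ (g y).2 hP hc hφ
  have h3 : ∑ i, φ (c i) * m μ i - ∑ i, φ (c i) * m (g y) i ≤ δ / 4 := by
    -- Both mass vectors sum to one, so a constant may be subtracted from `φ`.
    calc ∑ i, φ (c i) * m μ i - ∑ i, φ (c i) * m (g y) i
        = ∑ i, (φ (c i) - φ (c 0)) * (m μ i - m (g y) i) := by
          have e1 : ∑ i, m μ i = 1 := sum_measureReal_preimage μ.1 hP
          have e2 : ∑ i, m (g y) i = 1 := sum_measureReal_preimage (g y).1 hP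
          simp only [sub_mul, mul_sub, Finset.sum_sub_distrib, ← Finset.mul_sum, e1, e2]
          ring
      _ ≤ ∑ _i : Fin (N + 1), (R + 1) * (δ / (4 * (N + 1) * (R + 1))) := by
          refine Finset.sum_le_sum fun i _ => (le_abs_self _).trans ?_
          rw [abs_mul]
          refine mul_le_mul ?_ ((dist_le_pi_dist (m μ) (m (g y)) i).trans hμy.le) (abs_nonneg _)
            (by positivity)
          have h4 := hφ.dist_le_mul (c i) (c 0)
          rw [NNReal.coe_one, one_mul] at h4
          have h5 := Metric.dist_le_diam_of_mem hΩ.isBounded (hcΩ i) (hcΩ 0)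
          rw [Real.dist_eq] at h4
          linarith
      _ = δ / 4 := by
          simp
          field_simp
  rw [abs_le] at h1 h2
  simp only [m] at h3
  linarith

/-! ### Approximation by maxima of minima -/

section MaxMin

variable {ι κ : Type*} [Fintype ι] [Nonempty ι] [Fintype κ] [Nonempty κ]

theorem le_maxMin {f : ι → κ → ℝ} {a : ℝ} (i : ι) (h : ∀ j, a ≤ f i j) : a ≤ maxMin f :=
  (Finset.le_inf' _ _ fun j _ => h j).trans
    (Finset.le_sup' (fun i => Finset.univ.inf' Finset.univ_nonempty (f i)) (Finset.mem_univ i))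

theorem maxMin_le {f : ι → κ → ℝ} {a : ℝ} (h : ∀ i, ∃ j, f i j ≤ a) : maxMin f ≤ a :=
  Finset.sup'_le _ _ fun i _ => by
    obtain ⟨j, hj⟩ := h i
    exact (Finset.inf'_le _ (Finset.mem_univ j)).trans hj

theorem maxMin_le_add {f g : ι → κ → ℝ} {r : ℝ} (h : ∀ i j, f i j ≤ g i j + r) :
    maxMin f ≤ maxMin g + r :=
  maxMin_le fun i => by
    obtain ⟨j, -, hj⟩ := Finset.exists_mem_eq_inf' Finset.univ_nonempty (g i)
    refine ⟨j, (h i j).trans (add_le_add_left ?_ r)⟩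
    rw [← hj]
    exact Finset.le_sup' (fun i => Finset.univ.inf' Finset.univ_nonempty (g i)) (Finset.mem_univ i)

theorem abs_maxMin_sub_le {f g : ι → κ → ℝ} {r : ℝ} (h : ∀ i j, |f i j - g i j| ≤ r) :
    |maxMin f - maxMin g| ≤ r := by
  have h1 := maxMin_le_add (f := f) (g := g) (r := r) fun i j => by
    linarith [(abs_le.1 (h i j)).2]
  have h2 := maxMin_le_add (f := g) (g := f) (r := r) fun i j => by
    linarith [(abs_le.1 (h i j)).1]
  rw [abs_le]
  constructor <;> linarith

end MaxMin

/-- A quantitative lattice Stone-Weierstrass theorem: let `f` and all `g i j` be `1`-Lipschitz for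
`ρ`, and let the points `P i` form a `δ`-net. If `g i j` agrees with `f` at `P i` and is at most
`f + δ` at `P j`, then the maximum over `i` of the minima over `j` of the `g i j` approximates
`f`. -/
theorem abs_maxMin_sub_le_of_net {ι X : Type*} [Fintype ι] [Nonempty ι] {ρ : X → X → ℝ}
    {P : ι → X} {f : X → ℝ} {g : ι → ι → X → ℝ} {δ : ℝ} (hf : ∀ x y, |f x - f y| ≤ ρ x y)
    (hg : ∀ i j x y, |g i j x - g i j y| ≤ ρ x y) (hP : ∀ x, ∃ i, ρ x (P i) ≤ δ)
    (hgi : ∀ i j, g i j (P i) = f (P i)) (hgj : ∀ i j, g i j (P j) ≤ f (P j) + δ) (x : X) :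
    |maxMin (fun i j => g i j x) - f x| ≤ 3 * δ := by
  obtain ⟨k, hk⟩ := hP x
  have h0 := abs_le.1 ((hf x (P k)).trans hk)
  have h1 : maxMin (fun i j => g i j x) ≤ f x + 3 * δ := maxMin_le fun i => ⟨k, by
    have h1 := abs_le.1 ((hg i k x (P k)).trans hk)
    linarith [hgj i k]⟩
  have h2 : f x - 2 * δ ≤ maxMin (fun i j => g i j x) := le_maxMin k fun j => by
    have h1 := abs_le.1 ((hg k j x (P k)).trans hk)
    linarith [hgi k j]
  have h3 : 0 ≤ δ := by linarith
  rw [abs_le]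
  constructor <;> linarith

theorem exists_norm_le_one_inner_eq_norm {d : ℕ} (z : E d) :
    ∃ u : E d, ‖u‖ ≤ 1 ∧ inner ℝ u z = ‖z‖ := by
  rcases eq_or_ne z 0 with rfl | hz
  · exact ⟨0, by simp, by simp⟩
  · have := norm_ne_zero_iff.2 hz
    refine ⟨‖z‖⁻¹ • z, by rw [norm_smul, norm_inv, norm_norm, inv_mul_cancel₀ this], ?_⟩
    rw [real_inner_smul_left, real_inner_self_eq_norm_sq]
    field_simp

theorem abs_inner_sub_inner_le {d : ℕ} {u : E d} (hu : ‖u‖ ≤ 1) (x y : E d) :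
    |inner ℝ u x - inner ℝ u y| ≤ ‖x - y‖ := by
  rw [← inner_sub_right]
  exact (abs_real_inner_le_norm _ _).trans (mul_le_of_le_one_left (norm_nonneg _) hu)

theorem lipschitzWith_maxMin_affine {d : ℕ} {κ : Type*} [Fintype κ] [Nonempty κ]
    (α : κ → κ → ℝ) {w : κ → κ → E d} (hw : ∀ k l, ‖w k l‖ ≤ 1) :
    LipschitzWith 1 fun x => maxMin fun k l => α k l - inner ℝ (w k l) x :=
  LipschitzWith.of_dist_le_mul fun x y => by
    rw [NNReal.coe_one, one_mul, Real.dist_eq, dist_eq_norm]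
    refine abs_maxMin_sub_le fun k l => ?_
    rw [sub_sub_sub_cancel_left, norm_sub_rev]
    exact abs_inner_sub_inner_le (hw k l) y x

/-- On a compact set, the `1`-Lipschitz functions are uniformly approximated by maxima of minima
of affine functions of slope at most one. The size of the array is independent of the function. -/
theorem exists_maxMin_affine_approx {d : ℕ} {Ω : Set (E d)} (hΩ : IsCompact Ω)
    (hne : Ω.Nonempty) {δ : ℝ} (hδ : 0 < δ) :
    ∃ N : ℕ, ∀ φ : E d → ℝ, LipschitzWith 1 φ →
      ∃ (α : Fin (N + 1) → Fin (N + 1) → ℝ) (w : Fin (N + 1) → Fin (N + 1) → E d),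
        (∀ k l, ‖w k l‖ ≤ 1) ∧
          ∀ x ∈ Ω, |maxMin (fun k l => α k l - inner ℝ (w k l) x) - φ x| ≤ δ := by
  obtain ⟨N, c, P, -, hcΩ, hc⟩ := exists_cells hΩ hne (show 0 < δ / 3 by positivity)
  refine ⟨N, fun φ hφ => ?_⟩
  choose u hu hinner using fun k l => exists_norm_le_one_inner_eq_norm (c l - c k)
  have hφ' : ∀ x y, |φ x - φ y| ≤ ‖x - y‖ := fun x y => by
    simpa [Real.dist_eq, dist_eq_norm] using hφ.dist_le_mul x y
  refine ⟨fun k l => φ (c k) + inner ℝ (u k l) (c k), u, hu, fun x hx => ?_⟩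
  have := abs_maxMin_sub_le_of_net (X := Ω) (ρ := fun x y => ‖(x : E d) - y‖)
    (P := fun i => ⟨c i, hcΩ i⟩) (f := fun x => φ x) (δ := δ / 3)
    (g := fun k l x => φ (c k) + inner ℝ (u k l) (c k) - inner ℝ (u k l) (x : E d))
    (fun x y => hφ' x y) (fun k l x y => by
      rw [sub_sub_sub_cancel_left, norm_sub_rev]
      exact abs_inner_sub_inner_le (hu k l) _ _)
    (fun x => ⟨P x, by simpa [dist_eq_norm] using hc x x.2⟩)
    (fun k l => by simp) (fun k l => by
      have h1 := hinner k l
      have h2 := (abs_le.1 (hφ' (c l) (c k))).1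
      rw [inner_sub_right] at h1
      simp only
      linarith) ⟨x, hx⟩
  simp only at this
  linarith

/-- The hard half of Kantorovich-Rubinstein duality, with test functions that are maxima of minima
of affine functions. -/
theorem exists_maxMin_affine_W₁_le {d : ℕ} {Ω : Set (E d)} (hΩ : IsCompact Ω)
    (hne : Ω.Nonempty) {δ : ℝ} (hδ : 0 < δ) :
    ∃ N : ℕ, ∀ μ ∈ Prob Ω, ∀ ν ∈ Prob Ω,
      ∃ (α : Fin (N + 1) → Fin (N + 1) → ℝ) (w : Fin (N + 1) → Fin (N + 1) → E d),
        (∀ k l, ‖w k l‖ ≤ 1) ∧ (W₁ μ ν).toReal ≤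
          ∫ y, maxMin (fun k l => α k l - inner ℝ (w k l) y) ∂(μ : Measure (E d)) -
            ∫ y, maxMin (fun k l => α k l - inner ℝ (w k l) y) ∂(ν : Measure (E d)) + δ := by
  obtain ⟨N, hN⟩ := exists_maxMin_affine_approx hΩ hne (show 0 < δ / 3 by positivity)
  refine ⟨N, fun μ hμ ν hν => ?_⟩
  obtain ⟨φ, hφ, hle⟩ := exists_lipschitz_W₁_le hΩ hμ hν (show 0 < δ / 3 by positivity)
  obtain ⟨α, w, hw, happ⟩ := hN φ hφ
  have h : ∀ ρ ∈ Prob Ω, |∫ y, maxMin (fun k l => α k l - inner ℝ (w k l) y)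
      ∂(ρ : Measure (E d)) - ∫ y, φ y ∂(ρ : Measure (E d))| ≤ δ / 3 := fun ρ hρ => by
    rw [← integral_sub
      (integrable_of_mem_prob hΩ hρ (lipschitzWith_maxMin_affine α hw).continuous)
      (integrable_of_mem_prob hΩ hρ hφ.continuous)]
    have h1 : ∀ᵐ y ∂(ρ : Measure (E d)),
        ‖maxMin (fun k l => α k l - inner ℝ (w k l) y) - φ y‖ ≤ δ / 3 := by
      filter_upwards [ae_mem_of_mem_prob hρ] with y hy using happ y hy
    simpa using norm_integral_le_of_norm_le_const h1
  have h1 := abs_le.1 (h μ hμ)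
  have h2 := abs_le.1 (h ν hν)
  exact ⟨α, w, hw, by linarith⟩

theorem abs_sub_le_of_mem_lipClass {d : ℕ} {Ω : Set (E d)} (hΩ : IsCompact Ω) {C : ℝ}
    (hC : 0 ≤ C) {Λ : Prob Ω × Ω → ℝ} (hΛ : Λ ∈ LipClass Ω C) (p q : Prob Ω × Ω) :
    |Λ p - Λ q| ≤ C * (W₁ p.1.1 q.1.1).toReal + ‖(p.2 : E d) - q.2‖ := by
  have h1 := hΛ.2 p.1 q.1 p.2
  rw [← ENNReal.ofReal_toReal (W₁_ne_top hΩ p.1.2 q.1.2), ← ENNReal.ofReal_mul hC,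
    ENNReal.ofReal_le_ofReal_iff (by positivity)] at h1
  exact (abs_sub_le _ (Λ (q.1, p.2)) _).trans (add_le_add h1 (hΛ.1 q.1 p.2 q.2))

theorem mem_lipClass_of_abs_sub_le {d : ℕ} {Ω : Set (E d)} (hΩ : IsCompact Ω) {C : ℝ}
    (hC : 0 ≤ C) {Λ : Prob Ω × Ω → ℝ} (hx : ∀ μ x y, |Λ (μ, x) - Λ (μ, y)| ≤ ‖(x : E d) - y‖)
    (hμ : ∀ μ ν x, |Λ (μ, x) - Λ (ν, x)| ≤ C * (W₁ μ.1 ν.1).toReal) : Λ ∈ LipClass Ω C := by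
  refine ⟨hx, fun μ ν x => ?_⟩
  rw [← ENNReal.ofReal_toReal (W₁_ne_top hΩ μ.2 ν.2), ← ENNReal.ofReal_mul hC]
  exact ENNReal.ofReal_le_ofReal (hμ μ ν x)

/-! ### Transformers compute maxima of minima -/

theorem map_mem_prob_image {d h : ℕ} {Ω : Set (E d)} (hΩ : IsCompact Ω)
    {μ : ProbabilityMeasure (E d)} (hμ : μ ∈ Prob Ω) {g : E d → E h} (hg : Continuous g) :
    μ.map hg.measurable.aemeasurable ∈ Prob (g '' Ω) := by
  change (μ : Measure (E d)).map g (g '' Ω)ᶜ = 0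
  rw [Measure.map_apply hg.measurable (hΩ.image hg).measurableSet.compl]
  exact measure_mono_null (fun x hx hxΩ => hx ⟨x, hxΩ, rfl⟩) hμ

/-- Pure averaging is an attention layer: if every value `B y` is orthogonal to all of `Ω`, then
`(μ, x) ↦ x - C ∫ B y dμ(y)` is realized by the key matrix `a B` with a small factor `a` and the
step size `C / a`. -/
theorem exists_averaging_layer {h : ℕ} {Ω : Set (E h)} (hΩ : IsCompact Ω) {C : ℝ} (hC : 0 ≤ C)
    (B : E h →L[ℝ] E h) (hB : ∀ x ∈ Ω, ∀ y, inner ℝ x (B y) = 0) :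
    ∃ (Ω' : Set (E h)) (Γ : AttentionLayer h Ω Ω'), IsCompact Ω' ∧ ∀ μ, ∀ x ∈ Ω,
      (Γ.bar (μ, x)).2 = x - C • ∫ y, B y ∂(μ : Measure (E h)) := by
  obtain ⟨M, hM⟩ := hΩ.exists_bound_of_continuousOn B.continuous.continuousOn
  obtain ⟨K, hK⟩ := hΩ.exists_bound_of_continuousOn continuousOn_id
  set s := C * M ^ 2 + 1
  have hs : 0 < s := by positivity
  have hatt : ∀ (μ : ProbabilityMeasure (E h)), ∀ x ∈ Ω,
      attention (s⁻¹ • B) (C * s) μ x = x - C • ∫ y, B y ∂(μ : Measure (E h)) := by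
    intro μ x hx
    rw [attention_of_inner_eq_zero _ _ _ _ fun y => by simp [inner_smul_right, hB x hx y]]
    simp only [smul_apply, integral_smul, smul_smul]
    rw [mul_inv_cancel_right₀ hs.ne']
  refine ⟨Metric.closedBall 0 (K + C * M), ⟨s⁻¹ • B, C * s, by positivity, fun y hy => ?_,
    fun μ hμ x hx => ?_⟩, isCompact_closedBall _ _, hatt⟩
  · rw [smul_apply, norm_smul, mul_pow, Real.norm_eq_abs, sq_abs]
    have h1 : ‖B y‖ ^ 2 ≤ M ^ 2 := by
      gcongr
      exact hM y hy
    have h2 : C * ‖B y‖ ^ 2 ≤ s := (mul_le_mul_of_nonneg_left h1 hC).trans (by simp [s])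
    calc C * s * (s⁻¹ ^ 2 * ‖B y‖ ^ 2) = C * ‖B y‖ ^ 2 / s := by field_simp
      _ ≤ 1 := (div_le_one hs).2 h2
      _ ≤ 2 := one_le_two
  · rw [hatt μ x hx, mem_closedBall_zero_iff]
    have h1 : ‖∫ y, B y ∂(μ : Measure (E h))‖ ≤ M := by
      simpa using norm_integral_le_of_norm_le_const ((ae_mem_of_mem_prob hμ).mono hM)
    refine (norm_sub_le _ _).trans (add_le_add (hK x hx) ?_)
    rw [norm_smul, Real.norm_of_nonneg hC]
    exact mul_le_mul_of_nonneg_left h1 hC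

/-- The affine map with prescribed coordinate functions `⟨a s, x⟩ + β s`, indexed by an arbitrary
finite type. -/
theorem exists_affine_coords {d h : ℕ} {σ : Type*} (e : σ ≃ Fin h) (a : σ → E d) (β : σ → ℝ) :
    ∃ (A : E d →L[ℝ] E h) (b : E h), ∀ x s, (A x + b) (e s) = inner ℝ (a s) x + β s :=
  ⟨(EuclideanSpace.equiv (Fin h) ℝ).symm.toContinuousLinearMap ∘L
      ContinuousLinearMap.pi fun c => innerSL ℝ (a (e.symm c)),
    WithLp.toLp 2 (β ∘ e.symm), fun x s => by simp⟩

/-- The maxima of minima of sums of an affine function of the query and an average of a lattice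
polynomial over the context are computed exactly by Transformers. -/
theorem maxMin_mem_liftedTransformers {d : ℕ} {Ω : Set (E d)} (hΩ : IsCompact Ω) {C : ℝ}
    (hC : 0 ≤ C) {ι κ : Type*} [Fintype ι] [Nonempty ι] [Fintype κ] [Nonempty κ]
    (γ : ι × ι → ℝ) (u : ι × ι → E d) (α : ι × ι → κ → κ → ℝ) (w : ι × ι → κ → κ → E d) :
    (fun p : Prob Ω × Ω => maxMin fun i j : ι => γ (i, j) - inner ℝ (u (i, j)) (p.2 : E d) -
      C * ∫ y, maxMin (fun k l => α (i, j) k l - inner ℝ (w (i, j) k l) y)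
        ∂(p.1.1 : Measure (E d))) ∈ LiftedTransformers Ω := by
  classical
  obtain ⟨h, ⟨e⟩⟩ : ∃ h, Nonempty (((ι × ι) × κ × κ) ⊕ (ι × ι) ⊕ (ι × ι) ≃ Fin h) :=
    ⟨_, ⟨Fintype.equivFin _⟩⟩
  -- The coordinates `inl (p, k, l)` carry the affine pieces of the `p`-th test function,
  -- `inr (inl p)` collects the `p`-th entry of the outer array, and `inr (inr p)` holds its
  -- negative, which makes the state orthogonal to the values of the attention layer.
  obtain ⟨A, b, hAb⟩ := exists_affine_coords e
    (Sum.elim (fun s => - w s.1 s.2.1 s.2.2) (Sum.elim (fun p => - u p) u))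
    (Sum.elim (fun s => α s.1 s.2.1 s.2.2) (Sum.elim γ fun p => - γ p))
  set Q : E d → E h := fun x => A x + b with hQ
  have hQc : Continuous Q := by fun_prop
  let U : ι × ι → Finset (Fin h) := fun p =>
    Finset.univ.image fun q : κ × κ => e (Sum.inl (p, q.1, q.2))
  have hU : Pairwise fun p q => Disjoint (U p) (U q) := fun p q hpq => by
    simp only [U, Finset.disjoint_left, Finset.mem_image, Finset.mem_univ, true_and, not_exists,
      forall_exists_index]
    rintro _ a rfl b hb
    simp at hb
    exact hpq hb.1.symm
  choose s hs using fun p : ι × ι => exists_computes_maxMin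
    (fun k l : κ => e (Sum.inl (p, k, l))) (fun k k' l l' hkl => by simpa using hkl)
  obtain ⟨F, hF, hFs, hFo⟩ := exists_comparatorNet_forall hs hU Finset.univ
  have hFR : ∀ z x, F x (e (Sum.inr z)) = x (e (Sum.inr z)) := fun z x =>
    hFo _ (fun p _ => by simp) x
  let R : ι × ι → Fin h := fun p => e (Sum.inr (Sum.inl p))
  let R' : ι × ι → Fin h := fun p => e (Sum.inr (Sum.inr p))
  let B : E h →L[ℝ] E h := ∑ p, (EuclideanSpace.proj (s p)).smulRight
    (EuclideanSpace.single (R p) (1 : ℝ) + EuclideanSpace.single (R' p) (1 : ℝ))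
  have hBR : ∀ y p, B y (R p) = y (s p) := by
    intro y p
    simp [B, R, R', Finset.sum_apply, Pi.single_apply]
  have hB : ∀ x ∈ F '' (Q '' Ω), ∀ y, inner ℝ x (B y) = 0 := by
    rintro _ ⟨_, ⟨x, -, rfl⟩, rfl⟩ y
    simp only [B, sum_apply, inner_sum]
    refine Finset.sum_eq_zero fun p _ => ?_
    simp [inner_add_right, inner_smul_right, EuclideanSpace.inner_single_right, R, R', hFR, hQ, hAb]
    ring
  have hΩ₁ : IsCompact (Q '' Ω) := hΩ.image hQc
  obtain ⟨L₁, S₁, -, hS₁, hp₁⟩ := hF.exists_composition hΩ₁ (.nil hΩ₁)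
  have hΩ₂ : IsCompact (F '' (Q '' Ω)) := hΩ₁.image hF.continuous
  obtain ⟨Ω₃, Γ, hΩ₃, hΓ⟩ := exists_averaging_layer hΩ₂ hC B hB
  have hS₂ := hS₁.layer hΩ₃ hΩ₃ Γ (idMLPLayer Ω₃)
  obtain ⟨r, -, -, G, hG, hGr, -⟩ := exists_computes_maxMin (fun i j : ι => R (i, j))
    (fun i i' j j' hij => by simpa [R] using hij)
  obtain ⟨L₃, S₃, hL₃, hS₃, hp₃⟩ := hG.exists_composition hΩ₃ hS₂
  refine ⟨h, A, b, EuclideanSpace.single r 1, Q '' Ω, Prod.snd ∘ S₃, hΩ₁,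
    fun x hx => ⟨x, hx, rfl⟩, ⟨L₃, S₃, _, le_trans (Nat.le_add_left _ _) hL₃, hS₃, rfl⟩,
    fun μ x => ?_⟩
  have hFQ : Continuous (F ∘ Q) := hF.continuous.comp hQc
  have hs₁ : S₁ (liftBar A b (μ.1, x.1)) = (μ.1.map hFQ.measurable.aemeasurable, F (Q x)) := by
    rw [hp₁]
    exact Prod.ext (probabilityMeasure_map_map _ hQc.measurable hF.continuous.measurable) rfl
  have hmem : μ.1.map hFQ.measurable.aemeasurable ∈ Prob (F '' (Q '' Ω)) := by
    rw [← Set.image_comp]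
    exact map_mem_prob_image hΩ μ.2 hFQ
  have hz : (S₃ (liftBar A b (μ.1, x.1))).2 = G (F (Q x) - C • ∫ y, B y
      ∂(μ.1.map hFQ.measurable.aemeasurable : Measure (E h))) := by
    rw [hp₃, ← hΓ _ _ ⟨Q x, ⟨x, x.2, rfl⟩, rfl⟩, ← hs₁]
    simp [MLPLayer.bar, idMLPLayer, mlp]
  rw [Function.comp, hz, EuclideanSpace.inner_single_left]
  simp only [map_one, one_mul, hGr]
  congr 1
  funext i j
  rw [PiLp.sub_apply, PiLp.smul_apply, smul_eq_mul]
  have hint : (∫ y, B y ∂(μ.1.map hFQ.measurable.aemeasurable : Measure (E h))) (R (i, j)) =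
      ∫ y, maxMin (fun k l => α (i, j) k l - inner ℝ (w (i, j) k l) y)
        ∂(μ.1 : Measure (E d)) := by
    have h1 := (EuclideanSpace.proj (R (i, j)) : E h →L[ℝ] ℝ).integral_comp_comm
      (integrable_of_mem_prob hΩ₂ hmem B.continuous)
    simp only [PiLp.proj_apply, hBR] at h1
    rw [← h1, ProbabilityMeasure.toMeasure_map, integral_map hFQ.measurable.aemeasurable
      (by fun_prop)]
    refine integral_congr_ae (.of_forall fun y => ?_)
    simp only [Function.comp, hFs _ (Finset.mem_univ _), hQ, hAb]
    simp [neg_add_eq_sub]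
  rw [hint]
  simp [R, hFR, hQ, hAb, neg_add_eq_sub]

/-! ### Membership in the Lipschitz class and conclusion -/

theorem maxMin_mem_lipClass {d : ℕ} {Ω : Set (E d)} (hΩ : IsCompact Ω) {C : ℝ}
    (hC : 0 ≤ C) {ι κ : Type*} [Fintype ι] [Nonempty ι] [Fintype κ] [Nonempty κ]
    (γ : ι × ι → ℝ) {u : ι × ι → E d} (hu : ∀ p, ‖u p‖ ≤ 1) (α : ι × ι → κ → κ → ℝ)
    {w : ι × ι → κ → κ → E d} (hw : ∀ p k l, ‖w p k l‖ ≤ 1) :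
    (fun p : Prob Ω × Ω => maxMin fun i j : ι => γ (i, j) - inner ℝ (u (i, j)) (p.2 : E d) -
      C * ∫ y, maxMin (fun k l => α (i, j) k l - inner ℝ (w (i, j) k l) y)
        ∂(p.1.1 : Measure (E d))) ∈ LipClass Ω C := by
  refine mem_lipClass_of_abs_sub_le hΩ hC (fun μ x y => abs_maxMin_sub_le fun i j => ?_)
    (fun μ ν x => abs_maxMin_sub_le fun i j => ?_)
  · rw [sub_sub_sub_cancel_right, sub_sub_sub_cancel_left, norm_sub_rev]
    exact abs_inner_sub_inner_le (hu _) _ _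
  · rw [sub_sub_sub_cancel_left, ← mul_sub, abs_mul, abs_of_nonneg hC, abs_sub_comm]
    exact mul_le_mul_of_nonneg_left (abs_integral_sub_integral_le hΩ μ.2 ν.2
      (lipschitzWith_maxMin_affine _ (hw _))) hC

theorem mem_liftedTransformers_of_isEmpty {d : ℕ} {Ω : Set (E d)} (h0 : IsEmpty (Prob Ω × Ω))
    (Λ : Prob Ω × Ω → ℝ) : Λ ∈ LiftedTransformers Ω := by
  have hc : IsCompact ({0} : Set (E 0)) := isCompact_singleton
  exact ⟨0, 0, 0, 0, {0}, _, hc, fun x _ => Subsingleton.elim _ _,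
    ⟨1, _, _, le_rfl, (Composition.nil hc).layer hc hc (idAttentionLayer _) (idMLPLayer _), rfl⟩,
    fun μ x => h0.elim (μ, x)⟩

end LipTransformer

open LipTransformer in
theorem theorem1 (C : ℝ) (hC : 0 < C) (d : ℕ) (Ω : Set (LipTransformer.E d))
    (hΩ : IsCompact Ω) (ε : ℝ) (hε : ε ∈ Set.Ioo (0 : ℝ) 1)
    (Λstar : LipTransformer.Prob Ω × Ω → ℝ)
    (hΛstar : Λstar ∈ LipTransformer.LipClass Ω C) :
    ∃ Λ ∈ LipTransformer.𝒢 Ω C,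
      ∀ p : LipTransformer.Prob Ω × Ω, |Λ p - Λstar p| ≤ ε := by
  rcases isEmpty_or_nonempty (Prob Ω × Ω) with h0 | ⟨⟨μ₀, x₀⟩⟩
  · exact ⟨Λstar, ⟨hΛstar, mem_liftedTransformers_of_isEmpty h0 Λstar⟩, h0.elim⟩
  have hne : Ω.Nonempty := ⟨x₀, x₀.2⟩
  have hε0 := hε.1
  -- An `ε / 3`-net of `𝒫(Ω) × Ω`, and test functions that nearly attain the Wasserstein distances
  -- of its points.
  obtain ⟨t, htf, ht⟩ := exists_finite_W₁_net hΩ (show 0 < ε / (6 * C) by positivity)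
  obtain ⟨N, c, P, -, hcΩ, hc⟩ := exists_cells hΩ hne (show 0 < ε / 6 by positivity)
  obtain ⟨M, hM⟩ := exists_maxMin_affine_W₁_le hΩ hne (show 0 < ε / (3 * C) by positivity)
  have := htf.fintype
  have : Nonempty t := by
    obtain ⟨ν, hν, -⟩ := ht μ₀
    exact ⟨ν, hν⟩
  let ι := t × Fin (N + 1)
  let p : ι → Prob Ω × Ω := fun i => (i.1, ⟨c i.2, hcΩ i.2⟩)
  choose α w hw hW using fun q : ι × ι => hM (p q.2).1 (p q.2).1.2 (p q.1).1 (p q.1).1.2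
  choose u hu hinner using fun q : ι × ι =>
    exists_norm_le_one_inner_eq_norm (((p q.2).2 : E d) - ((p q.1).2 : E d))
  let I : ι × ι → Prob Ω → ℝ := fun q μ =>
    ∫ y, maxMin (fun k l => α q k l - inner ℝ (w q k l) y) ∂(μ.1 : Measure (E d))
  let γ : ι × ι → ℝ := fun q => Λstar (p q.1) + inner ℝ (u q) ((p q.1).2 : E d) + C * I q (p q.1).1
  refine ⟨_, ⟨maxMin_mem_lipClass hΩ hC.le γ hu α hw,
    maxMin_mem_liftedTransformers hΩ hC.le γ u α w⟩,
    fun x => ?_⟩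
  have key := abs_maxMin_sub_le_of_net
    (ρ := fun p q : Prob Ω × Ω => C * (W₁ p.1.1 q.1.1).toReal + ‖(p.2 : E d) - q.2‖)
    (P := p) (f := Λstar) (δ := ε / 3)
    (g := fun i j x => γ (i, j) - inner ℝ (u (i, j)) (x.2 : E d) - C * I (i, j) x.1)
    (abs_sub_le_of_mem_lipClass hΩ hC.le hΛstar) (fun i j x y => ?_) (fun x => ?_)
    (fun i j => ?_) (fun i j => ?_) x
  · exact key.trans_eq (by ring)
  · have h1 := abs_inner_sub_inner_le (hu (i, j)) (y.2 : E d) x.2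
    have h2 := mul_le_mul_of_nonneg_left (abs_integral_sub_integral_le hΩ x.1.2 y.1.2
      (lipschitzWith_maxMin_affine (α (i, j)) (hw (i, j)))) hC.le
    rw [← abs_of_pos hC, ← abs_mul, abs_of_pos hC, abs_le, mul_sub] at h2
    rw [abs_le, norm_sub_rev] at h1
    simp only [I]
    rw [abs_le]
    constructor <;> linarith
  · obtain ⟨ν, hν, hle⟩ := ht x.1
    refine ⟨(⟨ν, hν⟩, P x.2), ?_⟩
    have h1 := mul_le_mul_of_nonneg_left hle hC.le
    have h2 : C * (ε / (6 * C)) = ε / 6 := by field_simp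
    have h3 := hc x.2 x.2.2
    rw [dist_eq_norm] at h3
    simp only [p]
    linarith
  · simp only [γ]
    ring
  · have h1 := hinner (i, j)
    have h2 := mul_le_mul_of_nonneg_left (hW (i, j)) hC.le
    have h3 : C * (ε / (3 * C)) = ε / 3 := by field_simp
    have h4 := (abs_le.1 (abs_sub_le_of_mem_lipClass hΩ hC.le hΛstar (p j) (p i))).1
    rw [inner_sub_right] at h1
    simp only [γ, I]
    simp only [mul_add, mul_sub, h3] at h2
    simp only at h1
    linarith
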